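/- Let $\mathcal{O}$ be a complete discrete valuation ring with finite residue field and let $\Lambda=\mathcal{O}[[T]]$ be the ring of formal power series in one variable over $\mathcal{O}$. For a finitely generated $\Lambda$-module $M$ and an integer $i\ge 0$, the $i$-th Fitting ideal $\mathrm{Fitt}_i(M)$ is defined by choosing a presentation $\Lambda^k\xrightarrow{A}\Lambda^n\to M\to 0$ and letting $\mathrm{Fitt}_i(M)$ be the ideal generated by the minors of order $n-i$ of $A$ if $i\le n$, and $\mathrm{Fitt}_i(M)=\Lambda$ if $i>n$ (this does not depend on the presentation). A finitely generated $\Lambda$-module $P$ is pseudo-null if $P_{\mathfrak p}=0$ for every prime ideal $\mathfrak p$ of $\Lambda$ of height at most $1$; finitely generated $\Lambda$-modules $M$ and $N$ are pseudo-isomorphic if there is a $\Lambda$-linear map $f:M\to N$ such that $\ker(f)$ and $\mathrm{coker}(f)$ are pseudo-null. For ideals $I,J$ of $\Lambda$ write $I\sim J$ if there are ideals $\mathfrak a,\mathfrak b$ of $\Lambda$ of height $2$ such that $\mathfrak a I\subseteq J$ and $\mathfrak b J\subseteq I$. **Theorem.** Let $M$ be a non-trivial finitely generated torsion $\Lambda$-module.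 The pseudo-isomorphism class of $M$ is uniquely determined by the classes modulo $\sim$ of the ideals $\mathrm{Fitt}_i(M)$ for $i\ge 0$; that is, for every finitely generated torsion $\Lambda$-module $N$, the modules $M$ and $N$ are pseudo-isomorphic if and only if $\mathrm{Fitt}_i(M)\sim\mathrm{Fitt}_i(N)$ for all $i\ge 0$. -/

import Mathlib

open scoped PowerSeries

section FittingIdeals

variable {R : Type*} [CommRing R]

/-- The ideal `I_r(A)` generated by the minors of order `r` of the matrix `A`. Rows and columns are
selected by arbitrary functions: a repetition gives determinant `0`, and a permutation only changes
the sign. In particular `I_0(A) = R`, and `I_r(A) = 0` when `r` exceeds the number of rows or the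
number of columns. -/
def minorIdeal {m k : Type*} (A : Matrix m k R) (r : ℕ) : Ideal R :=
  Ideal.span {d | ∃ (f : Fin r → m) (g : Fin r → k), d = (A.submatrix f g).det}

/-- The matrix `A` and the map `π` form a presentation `R^k --A--> R^n --π--> M --> 0`. -/
structure IsMatrixPresentation {M : Type*} [AddCommGroup M] [Module R M] {n k : ℕ}
    (A : Matrix (Fin n) (Fin k) R) (π : (Fin n → R) →ₗ[R] M) : Prop where
  exact : LinearMap.range A.mulVecLin = LinearMap.ker π
  surjective : Function.Surjective π

/-- The `i`-th Fitting ideal read off a matrix with `n` rows: `I_{n-i}(A)` for `i ≤ n`, and the unit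
ideal for `i > n`. -/
def matrixFittingIdeal {n k : ℕ} (A : Matrix (Fin n) (Fin k) R) (i : ℕ) : Ideal R :=
  if i ≤ n then minorIdeal A (n - i) else ⊤

open Classical in
/-- The `i`-th Fitting ideal of a finitely presented module `M`: choose a finite presentation with
matrix `A` and take `I_{n-i}(A)`. It does not depend on the choice, see `fittingIdeal_eq` below.
(The value is `0` for modules without finite presentation.) -/
noncomputable def fittingIdeal (R : Type*) [CommRing R] (M : Type*) [AddCommGroup M] [Module R M]
    (i : ℕ) : Ideal R :=
  if h : ∃ (n k : ℕ) (A : Matrix (Fin n) (Fin k) R) (π : (Fin n → R) →ₗ[R] M),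
      IsMatrixPresentation A π
  then matrixFittingIdeal h.choose_spec.choose_spec.choose i
  else ⊥

/-! Independence of the presentation. -/

theorem det_submatrix_mem_minorIdeal {m k ι : Type*} [Fintype ι] [DecidableEq ι]
    (A : Matrix m k R) {r : ℕ} (h : Fintype.card ι = r) (f : ι → m) (g : ι → k) :
    (A.submatrix f g).det ∈ minorIdeal A r := by
  let e : Fin r ≃ ι := (Fintype.equivFinOfCardEq h).symm
  refine Ideal.subset_span ⟨f ∘ e, g ∘ e, ?_⟩
  rw [← Matrix.submatrix_submatrix, Matrix.det_submatrix_equiv_self]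

theorem minorIdeal_le {m k : Type*} {A : Matrix m k R} {r : ℕ} {I : Ideal R}
    (h : ∀ (f : Fin r → m) (g : Fin r → k), (A.submatrix f g).det ∈ I) : minorIdeal A r ≤ I := by
  refine Ideal.span_le.2 ?_
  rintro _ ⟨f, g, rfl⟩
  exact h f g

theorem minorIdeal_zero {m k : Type*} (A : Matrix m k R) : minorIdeal A 0 = ⊤ := by
  rw [Ideal.eq_top_iff_one]
  exact Ideal.subset_span ⟨Fin.elim0, Fin.elim0, by simp⟩

theorem matrixFittingIdeal_eq_minorIdeal {n k : ℕ} (A : Matrix (Fin n) (Fin k) R) (i : ℕ) :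
    matrixFittingIdeal A i = minorIdeal A (n - i) := by
  unfold matrixFittingIdeal
  split_ifs with h
  · rfl
  · rw [Nat.sub_eq_zero_of_le (by omega), minorIdeal_zero]

theorem minorIdeal_transpose_le {m k : Type*} (A : Matrix m k R) (r : ℕ) :
    minorIdeal A.transpose r ≤ minorIdeal A r := by
  refine minorIdeal_le fun f g => ?_
  rw [← Matrix.det_transpose]
  exact det_submatrix_mem_minorIdeal A (by simp) g f

theorem minorIdeal_mul_le_right {m l k : Type*} [Fintype l] (P : Matrix m l R) (A : Matrix l k R)
    (r : ℕ) : minorIdeal (P * A) r ≤ minorIdeal A r := by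
  classical
  refine minorIdeal_le fun f g => ?_
  have h1 : (P * A).submatrix f g = fun a => ∑ x, P (f a) x • (fun b => A x (g b)) := by
    ext a b
    simp [Matrix.mul_apply]
  have h2 : ((P * A).submatrix f g).det
      = ∑ c : Fin r → l, (∏ a, P (f a) (c a)) * (A.submatrix c g).det := by
    rw [h1]
    change (Matrix.detRowAlternating (R := R) (n := Fin r)).toMultilinearMap
      (fun a => ∑ x, P (f a) x • (fun b => A x (g b))) = _
    rw [MultilinearMap.map_sum]
    refine Finset.sum_congr rfl fun c _ => ?_
    rw [MultilinearMap.map_smul_univ]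
    rfl
  rw [h2]
  exact Ideal.sum_mem _ fun c _ =>
    Ideal.mul_mem_left _ _ (det_submatrix_mem_minorIdeal A (by simp) c g)

theorem minorIdeal_mul_le_left {m l k : Type*} [Fintype l] (A : Matrix m l R) (Q : Matrix l k R)
    (r : ℕ) : minorIdeal (A * Q) r ≤ minorIdeal A r := by
  have h := minorIdeal_transpose_le (A * Q).transpose r
  rw [Matrix.transpose_transpose, Matrix.transpose_mul] at h
  exact h.trans ((minorIdeal_mul_le_right _ _ r).trans (minorIdeal_transpose_le A r))

theorem minorIdeal_succ_le {m k : Type*} (A : Matrix m k R) (r : ℕ) :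
    minorIdeal A (r + 1) ≤ minorIdeal A r := by
  refine minorIdeal_le fun f g => ?_
  rw [Matrix.det_succ_row_zero]
  refine Ideal.sum_mem _ fun j _ => Ideal.mul_mem_left _ _ ?_
  rw [Matrix.submatrix_submatrix]
  exact det_submatrix_mem_minorIdeal A (by simp) _ _

theorem exists_map_castSucc {α : Type*} {t : ℕ} (x : α ⊕ Fin (t + 1))
    (hx : x ≠ Sum.inr (Fin.last t)) : ∃ y : α ⊕ Fin t, x = Sum.map id Fin.castSucc y := by
  rcases x with x | x
  · exact ⟨Sum.inl x, rfl⟩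
  · obtain ⟨y, hy⟩ := Fin.exists_castSucc_eq (i := x) |>.2 (fun h => hx (by rw [h]))
    exact ⟨Sum.inr y, by rw [← hy]; rfl⟩

theorem minorIdeal_fromBlocks_one_le {m k : Type*} (A : Matrix m k R) (t r : ℕ) :
    minorIdeal (Matrix.fromBlocks A 0 0 (1 : Matrix (Fin t) (Fin t) R)) (r + t)
      ≤ minorIdeal A r := by
  classical
  induction t generalizing r with
  | zero =>
    refine minorIdeal_le fun f g => ?_
    have hf : ∀ a, ∃ b, f a = Sum.inl b := fun a => by
      rcases f a with b | b
      · exact ⟨b, rfl⟩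
      · exact b.elim0
    have hg : ∀ a, ∃ b, g a = Sum.inl b := fun a => by
      rcases g a with b | b
      · exact ⟨b, rfl⟩
      · exact b.elim0
    choose f' hf' using hf
    choose g' hg' using hg
    have : (Matrix.fromBlocks A 0 0 (1 : Matrix (Fin 0) (Fin 0) R)).submatrix f g
        = A.submatrix f' g' := by
      ext a b
      simp [hf', hg']
    rw [this]
    exact det_submatrix_mem_minorIdeal A (by simp) _ _
  | succ t ih =>
    refine minorIdeal_le fun f g => ?_
    set B := Matrix.fromBlocks A 0 0 (1 : Matrix (Fin (t + 1)) (Fin (t + 1)) R) with hB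
    set C := Matrix.fromBlocks A 0 0 (1 : Matrix (Fin t) (Fin t) R) with hC
    -- the minors of `B` that avoid the last row
    have key : ∀ (s : ℕ) (f : Fin s → m ⊕ Fin (t + 1)) (g : Fin s → k ⊕ Fin (t + 1)),
        (∀ a, f a ≠ Sum.inr (Fin.last t)) → (B.submatrix f g).det ∈ minorIdeal C s := by
      intro s f g hf
      by_cases hg : ∃ b, g b = Sum.inr (Fin.last t)
      · obtain ⟨b, hb⟩ := hg
        rw [Matrix.det_eq_zero_of_column_eq_zero b]
        · exact Ideal.zero_mem _
        · intro a
          have := hf a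
          rw [Matrix.submatrix_apply, hb]
          rcases h : f a with x | x
          · simp [hB]
          · have hx : x ≠ Fin.last t := fun hx => this (by rw [h, hx])
            simp [hB, Matrix.one_apply_ne hx]
      · push Not at hg
        choose f' hf' using fun a => exists_map_castSucc (f a) (hf a)
        choose g' hg' using fun a => exists_map_castSucc (g a) (hg a)
        have : B.submatrix f g = C.submatrix f' g' := by
          ext a b
          rw [Matrix.submatrix_apply, Matrix.submatrix_apply, hf', hg']
          rcases f' a with x | x <;> rcases g' b with y | y <;>
            simp [hB, hC, Matrix.one_apply]
        rw [this]
        exact det_submatrix_mem_minorIdeal C (by simp) _ _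
    by_cases hf : ∃ a, f a = Sum.inr (Fin.last t)
    · obtain ⟨a, ha⟩ := hf
      by_cases hinj : Function.Injective f
      · rw [Matrix.det_succ_row _ a]
        refine Ideal.sum_mem _ fun j _ => Ideal.mul_mem_left _ _ ?_
        rw [Matrix.submatrix_submatrix]
        refine ih r (key _ _ _ fun b hb => ?_)
        exact Fin.succAbove_ne a b (hinj (hb.trans ha.symm))
      · rw [Function.Injective] at hinj
        push Not at hinj
        obtain ⟨x, y, hxy, hne⟩ := hinj
        rw [Matrix.det_zero_of_row_eq hne]
        · exact Ideal.zero_mem _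
        · funext j
          simp [hxy]
    · push Not at hf
      exact ih r (minorIdeal_succ_le C (r + t) (key _ f g hf))

theorem IsMatrixPresentation.fitting_le {M : Type*} [AddCommGroup M] [Module R M] {n k n' k' : ℕ}
    {A : Matrix (Fin n) (Fin k) R} {π : (Fin n → R) →ₗ[R] M}
    {A' : Matrix (Fin n') (Fin k') R} {π' : (Fin n' → R) →ₗ[R] M}
    (h : IsMatrixPresentation A π) (h' : IsMatrixPresentation A' π') (i : ℕ) :
    matrixFittingIdeal A' i ≤ matrixFittingIdeal A i := by
  classical
  rw [matrixFittingIdeal_eq_minorIdeal, matrixFittingIdeal_eq_minorIdeal]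
  by_cases hi : n < i
  · rw [Nat.sub_eq_zero_of_le hi.le, minorIdeal_zero]
    exact le_top
  -- each system of generators in terms of the other one
  choose b hb using fun j => h.surjective (π' (Pi.single j 1))
  choose c hc using fun j => h'.surjective (π (Pi.single j 1))
  let B : Matrix (Fin n) (Fin n') R := Matrix.of fun x y => b y x
  let C : Matrix (Fin n') (Fin n) R := Matrix.of fun x y => c y x
  have hB : ∀ v, π (B.mulVec v) = π' v := by
    intro v
    have : π ∘ₗ B.mulVecLin = π' := by
      refine LinearMap.pi_ext' fun j => LinearMap.ext_ring ?_
      simp only [LinearMap.comp_apply, Matrix.mulVecLin_apply, LinearMap.coe_single,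
        Matrix.mulVec_single_one]
      exact hb j
    exact LinearMap.congr_fun this v
  let D := Matrix.fromBlocks A B 0 (-1 : Matrix (Fin n') (Fin n') R)
  let D' := Matrix.fromBlocks (-1 : Matrix (Fin n) (Fin n) R) 0 C A'
  have hD : ∀ u v, π u + π' v = 0 → ∃ w, D.mulVec w = Sum.elim u v := by
    intro u v huv
    have : u + B.mulVec v ∈ LinearMap.ker π := by
      rw [LinearMap.mem_ker, map_add, hB, huv]
    rw [← h.exact] at this
    obtain ⟨w, hw⟩ := this
    refine ⟨Sum.elim w (-v), ?_⟩
    rw [Matrix.mulVecLin_apply] at hw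
    rw [Matrix.fromBlocks_mulVec]
    simp [hw, Matrix.mulVec_neg, Matrix.neg_mulVec]
  have hcol : ∀ y, ∃ w, D.mulVec w = fun x => D' x y := by
    rintro (y | y)
    · obtain ⟨w, hw⟩ := hD (-Pi.single y 1) (c y) (by rw [map_neg, hc]; simp)
      refine ⟨w, hw.trans ?_⟩
      funext x
      rcases x with x | x
      · simp [D', Matrix.one_apply, Pi.single_apply]
      · simp [D', C]
    · have hz : π' (A'.mulVec (Pi.single y 1)) = 0 := by
        rw [← LinearMap.mem_ker, ← h'.exact]
        exact ⟨_, rfl⟩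
      obtain ⟨w, hw⟩ := hD 0 (A'.mulVec (Pi.single y 1)) (by rw [map_zero, hz, add_zero])
      refine ⟨w, hw.trans ?_⟩
      funext x
      rcases x with x | x <;> simp [D']
  choose q hq using hcol
  have hDQ : D' = D * Matrix.of fun x y => q y x := by
    ext x y
    have := congrFun (hq y) x
    rw [← this]
    rfl
  have hDP : D = (Matrix.fromBlocks 1 B 0 (-1) : Matrix (Fin n ⊕ Fin n') (Fin n ⊕ Fin n') R) *
      (Matrix.fromBlocks A 0 0 1 : Matrix (Fin n ⊕ Fin n') (Fin k ⊕ Fin n') R) := by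
    rw [Matrix.fromBlocks_multiply]
    simp [D]
  have step : minorIdeal D' (n - i + n') ≤ minorIdeal A (n - i) := by
    refine le_trans ?_ (minorIdeal_fromBlocks_one_le A n' (n - i))
    refine le_trans ?_ (hDP ▸ minorIdeal_mul_le_right _ _ _)
    exact hDQ ▸ minorIdeal_mul_le_left _ _ _
  refine le_trans ?_ step
  by_cases hi' : i ≤ n'
  · refine minorIdeal_le fun f g => ?_
    have hdet := det_submatrix_mem_minorIdeal (ι := Fin n ⊕ Fin (n' - i)) (r := n - i + n') D'
      (by simp; omega) (Sum.map id f) (Sum.map id g)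
    have hsub : D'.submatrix (Sum.map id f) (Sum.map id g)
        = Matrix.fromBlocks (-1) 0 (C.submatrix f id) (A'.submatrix f g) := by
      ext x y
      rcases x with x | x <;> rcases y with y | y <;> simp [D']
    rw [hsub, Matrix.det_fromBlocks_zero₁₂, Matrix.det_neg, Matrix.det_one, mul_one] at hdet
    have := Ideal.mul_mem_left _ ((-1 : R) ^ Fintype.card (Fin n)) hdet
    rwa [← mul_assoc, ← mul_pow, neg_one_mul, neg_neg, one_pow, one_mul] at this
  · have hle : n - i + n' ≤ n := by omega
    have hdet := det_submatrix_mem_minorIdeal (r := n - i + n') D' (by simp)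
      (fun x : Fin (n - i + n') => Sum.inl (Fin.castLE hle x))
      (fun x : Fin (n - i + n') => Sum.inl (Fin.castLE hle x))
    have hsub : D'.submatrix (fun x : Fin (n - i + n') => Sum.inl (Fin.castLE hle x))
        (fun x : Fin (n - i + n') => Sum.inl (Fin.castLE hle x)) = -1 := by
      ext x y
      simp [D', Matrix.one_apply]
    rw [hsub, Matrix.det_neg, Matrix.det_one, mul_one] at hdet
    have := Ideal.mul_mem_left _ ((-1 : R) ^ Fintype.card (Fin (n - i + n'))) hdet
    rw [← mul_pow, neg_one_mul, neg_neg, one_pow] at this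
    rw [(Ideal.eq_top_iff_one _).2 this]
    exact le_top

/-- The Fitting ideals can be computed from any finite presentation. -/
theorem fittingIdeal_eq {M : Type*} [AddCommGroup M] [Module R M] {n k : ℕ}
    {A : Matrix (Fin n) (Fin k) R} {π : (Fin n → R) →ₗ[R] M} (h : IsMatrixPresentation A π)
    (i : ℕ) : fittingIdeal R M i = matrixFittingIdeal A i := by
  have hex : ∃ (n k : ℕ) (A : Matrix (Fin n) (Fin k) R) (π : (Fin n → R) →ₗ[R] M),
      IsMatrixPresentation A π := ⟨n, k, A, π, h⟩
  have hs := hex.choose_spec.choose_spec.choose_spec.choose_spec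
  rw [fittingIdeal, dif_pos hex]
  exact le_antisymm (h.fitting_le hs i) (hs.fitting_le h i)

end FittingIdeals

section PseudoIsomorphism

variable (R : Type*) [CommRing R]

/-- A (finitely generated) module `M` is pseudo-null if `M_𝔭 = 0` for all prime ideals `𝔭` of height
at most `1`. -/
def IsPseudoNull (M : Type*) [AddCommGroup M] [Module R M] : Prop :=
  ∀ (p : Ideal R) [p.IsPrime], p.height ≤ 1 → Subsingleton (LocalizedModule p.primeCompl M)

/-- There is a pseudo-isomorphism from `M` to `N`: a homomorphism whose kernel and cokernel are
pseudo-null. -/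
def IsPseudoIsomorphic (M N : Type*) [AddCommGroup M] [Module R M] [AddCommGroup N] [Module R N] :
    Prop :=
  ∃ f : M →ₗ[R] N, IsPseudoNull R (LinearMap.ker f) ∧ IsPseudoNull R (N ⧸ LinearMap.range f)

variable {R}

/-- `I ≺ J`: there is an ideal `𝔞` of height `2` with `𝔞 I ⊆ J`. -/
def IdealPrec (I J : Ideal R) : Prop :=
  ∃ a : Ideal R, a.height = 2 ∧ a * I ≤ J

/-- `I ∼ J`: both `I ≺ J` and `J ≺ I`. -/
def IdealSim (I J : Ideal R) : Prop :=
  IdealPrec I J ∧ IdealPrec J I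

end PseudoIsomorphism

/-! ### Fitting ideals and localization -/

section FittingLocalization

variable {R : Type*} [CommRing R]

/-! Both sides of the equivalence are seen at the primes of height at most 1. Since the maximal
ideal of Λ has height 2, `I ∼ J` means that `I` and `J` agree after localization at each such prime
(`idealSim_iff_forall_map_eq`), and Fitting ideals commute with localization
(`fittingIdeal_localizedModule`). A pseudo-isomorphism localizes to isomorphisms there, which gives
one direction.

For the converse, Λ is a noetherian factorial domain, so Λ_p is a discrete valuation ring for p of
height 1. Over such a ring the sum of the D/(ϖ^e_i) with e_0 ≤ e_1 ≤ ... ≤ e_(n-1) has (n-r)-th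
Fitting ideal generated by ϖ^(e_0+...+e_(r-1)), so the Fitting ideals recover all e_i and M_p ≅ N_p
(`nonempty_linearEquiv_of_fittingIdeal_eq`).

These local isomorphisms are glued without the structure theorem over Λ. Each lifts to a map f_p : M
→ N (`exists_isIsoAway`). Let a ≠ 0 annihilate M and N; only finitely many p of height 1 contain a.
Write a = c_p b_p with c_p a power of the generator of p and b_p ∉ p. Then ∑ b_p f_p is an
isomorphism at each of these primes (`exists_isIsoAway_of_finset`), and elsewhere both modules
vanish. -/

theorem exists_isMatrixPresentation (M : Type*) [AddCommGroup M] [Module R M]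
    [Module.FinitePresentation R M] :
    ∃ (n k : ℕ) (A : Matrix (Fin n) (Fin k) R) (π : (Fin n → R) →ₗ[R] M),
      IsMatrixPresentation A π := by
  obtain ⟨n, k, f, g, hf, hg⟩ := Module.FinitePresentation.exists_fin' R M
  refine ⟨n, k, LinearMap.toMatrix' g, f, ?_, hf⟩
  rw [← Matrix.toLin'_apply', Matrix.toLin'_toMatrix', ← LinearMap.exact_iff.1 hg]

theorem IsMatrixPresentation.comp_equiv {M N : Type*} [AddCommGroup M] [Module R M]
    [AddCommGroup N] [Module R N] {n k : ℕ} {A : Matrix (Fin n) (Fin k) R}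
    {π : (Fin n → R) →ₗ[R] M} (h : IsMatrixPresentation A π) (e : M ≃ₗ[R] N) :
    IsMatrixPresentation A (e.toLinearMap ∘ₗ π) where
  exact := by rw [h.exact, LinearEquiv.ker_comp]
  surjective := e.surjective.comp h.surjective

theorem fittingIdeal_congr {M N : Type*} [AddCommGroup M] [Module R M] [AddCommGroup N]
    [Module R N] [Module.FinitePresentation R M] (e : M ≃ₗ[R] N) (i : ℕ) :
    fittingIdeal R M i = fittingIdeal R N i := by
  obtain ⟨n, k, A, π, h⟩ := exists_isMatrixPresentation (R := R) M
  rw [fittingIdeal_eq h, fittingIdeal_eq (h.comp_equiv e)]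

theorem minorIdeal_map {S : Type*} [CommRing S] (φ : R →+* S) {m k : Type*} (A : Matrix m k R)
    (r : ℕ) : minorIdeal (A.map φ) r = (minorIdeal A r).map φ := by
  unfold minorIdeal
  rw [Ideal.map_span]
  congr 1
  ext d
  constructor
  · rintro ⟨f, g, rfl⟩
    exact ⟨_, ⟨f, g, rfl⟩, by rw [RingHom.map_det]; rfl⟩
  · rintro ⟨_, ⟨f, g, rfl⟩, rfl⟩
    exact ⟨f, g, by rw [RingHom.map_det]; rfl⟩

/-- Localization is exact, so it carries the presentation to one whose matrix is the entrywise image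
of `A`. -/
theorem IsMatrixPresentation.localization {M : Type*} [AddCommGroup M] [Module R M] {n k : ℕ}
    {A : Matrix (Fin n) (Fin k) R} {π : (Fin n → R) →ₗ[R] M} (h : IsMatrixPresentation A π)
    (S : Submonoid R) :
    ∃ π' : (Fin n → Localization S) →ₗ[Localization S] LocalizedModule S M,
      IsMatrixPresentation (A.map (algebraMap R (Localization S))) π' := by
  let ι (m : ℕ) : (Fin m → R) →ₗ[R] (Fin m → Localization S) :=
    .pi fun i => Algebra.linearMap R (Localization S) ∘ₗ .proj i
  have hι (m : ℕ) : IsLocalizedModule S (ι m) := inferInstance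
  let g := LocalizedModule.mkLinearMap S M
  -- A map out of a localized module is determined on the image of the original one, so standard
  -- basis vectors suffice.
  have hA : ((A.map (algebraMap R (Localization S))).mulVecLin).restrictScalars R
      = IsLocalizedModule.map S (ι k) (ι n) A.mulVecLin := by
    refine IsLocalizedModule.linearMap_ext S (ι k) (ι n) ?_
    rw [IsLocalizedModule.map_comp]
    ext j i
    simp [ι, Matrix.mulVec, dotProduct, Pi.single_apply]
  have hex := IsLocalizedModule.map_exact S (ι k) (ι n) g A.mulVecLin π
    (LinearMap.exact_iff.2 h.exact.symm)
  refine ⟨IsLocalizedModule.mapExtendScalars S (ι n) g (Localization S) π, ?_, ?_⟩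
  · ext x
    rw [LinearMap.mem_ker, IsLocalizedModule.mapExtendScalars_apply_apply, hex x, ← hA]
    rfl
  · exact IsLocalizedModule.map_surjective S (ι n) g π h.surjective

theorem fittingIdeal_localizedModule (M : Type*) [AddCommGroup M] [Module R M]
    [Module.FinitePresentation R M] (S : Submonoid R) (i : ℕ) :
    fittingIdeal (Localization S) (LocalizedModule S M) i
      = (fittingIdeal R M i).map (algebraMap R (Localization S)) := by
  obtain ⟨n, k, A, π, h⟩ := exists_isMatrixPresentation (R := R) M
  obtain ⟨π', h'⟩ := h.localization S
  rw [fittingIdeal_eq h, fittingIdeal_eq h', matrixFittingIdeal_eq_minorIdeal,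
    matrixFittingIdeal_eq_minorIdeal, minorIdeal_map]

end FittingLocalization

/-! ### Torsion modules over a discrete valuation ring -/

section DiscreteValuationRing

/-- When the image of `g` is listed in increasing order, its m-th element (from 0) is at least m. -/
theorem sum_range_le_sum_of_injective {n r : ℕ} {e : ℕ → ℕ} (he : MonotoneOn e (Set.Iio n))
    (g : Fin r → Fin n) (hg : Function.Injective g) :
    ∑ i ∈ Finset.range r, e i ≤ ∑ i, e (g i) := by
  have hcard : (Finset.univ.image g).card = r := by
    rw [Finset.card_image_of_injective _ hg, Finset.card_univ, Fintype.card_fin]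
  let o := (Finset.univ.image g).orderEmbOfFin hcard
  have hsum : ∑ i, e (g i) = ∑ i, e (o i) := by
    rw [← Finset.sum_image (f := fun x : Fin n => e x) hg.injOn,
      ← Finset.sum_image (f := fun x : Fin n => e x) (g := o) o.injective.injOn]
    congr 1
    exact (Finset.image_orderEmbOfFin_univ _ hcard).symm
  rw [hsum, ← Fin.sum_univ_eq_sum_range]
  refine Finset.sum_le_sum fun i _ => ?_
  have hle : ∀ (m : ℕ) (hm : m < r), m ≤ o ⟨m, hm⟩ := by
    intro m
    induction m with
    | zero => intro _; exact Nat.zero_le _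
    | succ m ih =>
      intro hm
      have : o ⟨m, by omega⟩ < o ⟨m + 1, hm⟩ := o.strictMono (by simp)
      exact (ih (by omega)).trans_lt this
  have := hle i i.2
  exact he (lt_of_le_of_lt this (o i).2) (o i).2 this

variable {D : Type*} [CommRing D]

/-- Each Leibniz term of a minor with distinct columns is zero or a product of r of the diagonal
powers, up to sign; the leading principal minor attains the least exponent. -/
theorem minorIdeal_diagonal_pow (ϖ : D) {n r : ℕ} (hr : r ≤ n) {e : ℕ → ℕ}
    (he : MonotoneOn e (Set.Iio n)) :
    minorIdeal (Matrix.diagonal fun i : Fin n => ϖ ^ e i) r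
      = Ideal.span {ϖ ^ ∑ i ∈ Finset.range r, e i} := by
  refine le_antisymm (minorIdeal_le fun f g => ?_) ?_
  · rw [Ideal.mem_span_singleton]
    by_cases hg : Function.Injective g
    · rw [Matrix.det_apply]
      refine Finset.dvd_sum fun σ _ => Dvd.dvd.mul_left ?_ _ |> fun h => by
        simpa [Units.smul_def, zsmul_eq_mul] using h
      have : (ϖ ^ ∑ i, e (g i)) ∣ ∏ i, (Matrix.diagonal fun i : Fin n => ϖ ^ e i).submatrix f g (σ i) i := by
        rw [← Finset.prod_pow_eq_pow_sum]
        refine Finset.prod_dvd_prod_of_dvd _ _ fun i _ => ?_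
        rw [Matrix.submatrix_apply, Matrix.diagonal_apply]
        split_ifs with h
        · rw [h]
        · exact dvd_zero _
      exact (pow_dvd_pow _ (sum_range_le_sum_of_injective he g hg)).trans this
    · rw [Function.Injective] at hg
      push Not at hg
      obtain ⟨x, y, hxy, hne⟩ := hg
      rw [Matrix.det_zero_of_column_eq hne]
      · exact dvd_zero _
      · intro j
        simp [hxy]
  · rw [Ideal.span_singleton_le_iff_mem]
    refine Ideal.subset_span ⟨Fin.castLE hr, Fin.castLE hr, ?_⟩
    rw [Matrix.submatrix_diagonal _ _ (Fin.castLE_injective hr), Matrix.det_diagonal,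
      ← Fin.sum_univ_eq_sum_range, ← Finset.prod_pow_eq_pow_sum]
    rfl

theorem isMatrixPresentation_diagonal {n : ℕ} (d : Fin n → D) :
    IsMatrixPresentation (Matrix.diagonal d)
      (LinearMap.pi fun i => (Ideal.span {d i}).mkQ ∘ₗ LinearMap.proj i) where
  exact := by
    ext v
    simp only [LinearMap.mem_range, Matrix.mulVecLin_apply, LinearMap.mem_ker]
    constructor
    · rintro ⟨w, rfl⟩
      funext i
      simp [Matrix.mulVec_diagonal]
    · intro h
      have h' : ∀ i, ∃ c, v i = d i * c := fun i => by
        exact Ideal.mem_span_singleton.1 (Ideal.Quotient.eq_zero_iff_mem.1 (congrFun h i))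
      choose w hw using h'
      exact ⟨w, funext fun i => by rw [Matrix.mulVec_diagonal, hw]⟩
  surjective := fun y => by
    choose v hv using fun i => (Ideal.span {d i}).mkQ_surjective (y i)
    exact ⟨v, funext hv⟩

/-- Padding by zero modules D/(ϖ^0), so that two modules can be written with the same number of
factors. -/
theorem nonempty_linearEquiv_pi_quotient_pow_sum_zero (ϖ : D) {ι κ : Type*} [Fintype ι]
    (e : ι → ℕ) :
    Nonempty (((i : ι) → D ⧸ Ideal.span {ϖ ^ e i}) ≃ₗ[D]
      ((i : ι ⊕ κ) → D ⧸ Ideal.span {ϖ ^ (Sum.elim e 0 i : ℕ)})) := by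
  have hsub : Subsingleton ((i : κ) → D ⧸ Ideal.span {ϖ ^ (Sum.elim e 0 (Sum.inr i : ι ⊕ κ) : ℕ)}) := by
    refine @Pi.instSubsingleton _ _ fun i => ?_
    rw [Ideal.Quotient.subsingleton_iff, Sum.elim_inr, Pi.zero_apply, pow_zero,
      Ideal.span_singleton_one]
  let φ := LinearEquiv.sumPiEquivProdPi D ι κ
    (fun i : ι ⊕ κ => D ⧸ Ideal.span {ϖ ^ (Sum.elim e 0 i : ℕ)})
  exact ⟨(φ.trans (LinearEquiv.ofBijective (LinearMap.fst D _ _)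
    ⟨fun x y h => Prod.ext h (Subsingleton.elim _ _), LinearMap.fst_surjective⟩)).symm⟩

theorem exists_monotoneOn_linearEquiv_pi_quotient_pow (ϖ : D) {ι : Type*} [Fintype ι] {n : ℕ}
    (hn : Fintype.card ι = n) (e : ι → ℕ) :
    ∃ e' : ℕ → ℕ, MonotoneOn e' (Set.Iio n) ∧
      Nonempty (((i : ι) → D ⧸ Ideal.span {ϖ ^ e i}) ≃ₗ[D]
        ((i : Fin n) → D ⧸ Ideal.span {ϖ ^ e' i})) := by
  let σ : Fin n ≃ ι := (Fintype.equivFinOfCardEq hn).symm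
  let τ := (Tuple.sort (e ∘ σ)).trans σ
  have hmono : Monotone (e ∘ τ) := Tuple.monotone_sort (e ∘ σ)
  refine ⟨fun i => if h : i < n then e (τ ⟨i, h⟩) else 0, ?_, ⟨?_⟩⟩
  · intro i hi j hj hij
    simp only [Set.mem_Iio] at hi hj
    simp only [hi, hj, dif_pos]
    exact hmono (a := ⟨i, hi⟩) (b := ⟨j, hj⟩) hij
  · exact (LinearEquiv.piCongrLeft D (fun i => D ⧸ Ideal.span {ϖ ^ e i}) τ).symm.trans
      (LinearEquiv.piCongrRight fun i => Submodule.quotEquivOfEq _ _ (by simp))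

theorem fittingIdeal_pi_quotient_pow {n : ℕ} {e : ℕ → ℕ} (he : MonotoneOn e (Set.Iio n)) (ϖ : D)
    (r : ℕ) (hr : r ≤ n) :
    fittingIdeal D ((i : Fin n) → D ⧸ Ideal.span {ϖ ^ e i}) (n - r)
      = Ideal.span {ϖ ^ ∑ i ∈ Finset.range r, e i} := by
  rw [fittingIdeal_eq (isMatrixPresentation_diagonal fun i : Fin n => ϖ ^ e i),
    matrixFittingIdeal_eq_minorIdeal, Nat.sub_sub_self hr, minorIdeal_diagonal_pow ϖ hr he]

variable [IsDomain D] [IsDiscreteValuationRing D]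

/-- Every large `n` is allowed, so that a common one can serve two modules. -/
theorem exists_linearEquiv_pi_quotient_pow {ϖ : D} (hϖ : Irreducible ϖ) (M : Type*)
    [AddCommGroup M] [Module D M] [Module.Finite D M] (hM : Module.IsTorsion D M) :
    ∃ n₀ : ℕ, ∀ n ≥ n₀, ∃ e : ℕ → ℕ, MonotoneOn e (Set.Iio n) ∧
      Nonempty (M ≃ₗ[D] ((i : Fin n) → D ⧸ Ideal.span {ϖ ^ e i})) := by
  classical
  obtain ⟨ι, _, p, hp, e, ⟨φ⟩⟩ := Module.equiv_directSum_of_isTorsion hM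
  refine ⟨Fintype.card ι, fun n hn => ?_⟩
  have φ₁ : ((i : ι) → D ⧸ Ideal.span {p i ^ e i}) ≃ₗ[D] ((i : ι) → D ⧸ Ideal.span {ϖ ^ e i}) :=
    LinearEquiv.piCongrRight fun i => Submodule.quotEquivOfEq _ _ (by
      rw [Ideal.span_singleton_eq_span_singleton]
      exact (IsDiscreteValuationRing.associated_of_irreducible D (hp i) hϖ).pow_pow)
  obtain ⟨φ₂⟩ := nonempty_linearEquiv_pi_quotient_pow_sum_zero ϖ (κ := Fin (n - Fintype.card ι)) e
  obtain ⟨e', he', ⟨φ₃⟩⟩ := exists_monotoneOn_linearEquiv_pi_quotient_pow ϖ (n := n)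
    (by simp; omega) (Sum.elim e (0 : Fin (n - Fintype.card ι) → ℕ))
  exact ⟨e', he', ⟨φ.trans ((DirectSum.linearEquivFunOnFintype D ι _).trans
    (φ₁.trans (φ₂.trans φ₃)))⟩⟩

theorem nonempty_linearEquiv_of_fittingIdeal_eq {M N : Type*} [AddCommGroup M] [Module D M]
    [Module.Finite D M] (hM : Module.IsTorsion D M) [AddCommGroup N] [Module D N]
    [Module.Finite D N] (hN : Module.IsTorsion D N)
    (h : ∀ i, fittingIdeal D M i = fittingIdeal D N i) : Nonempty (M ≃ₗ[D] N) := by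
  obtain ⟨ϖ, hϖ⟩ := IsDiscreteValuationRing.exists_irreducible D
  obtain ⟨a, ha⟩ := exists_linearEquiv_pi_quotient_pow hϖ M hM
  obtain ⟨b, hb⟩ := exists_linearEquiv_pi_quotient_pow hϖ N hN
  obtain ⟨e, he, ⟨φ⟩⟩ := ha (max a b) (le_max_left _ _)
  obtain ⟨e', he', ⟨φ'⟩⟩ := hb (max a b) (le_max_right _ _)
  have : Module.FinitePresentation D M := Module.finitePresentation_of_finite D M
  have : Module.FinitePresentation D N := Module.finitePresentation_of_finite D N
  have hsum : ∀ r ≤ max a b, ∑ i ∈ Finset.range r, e i = ∑ i ∈ Finset.range r, e' i := by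
    intro r hr
    have := h (max a b - r)
    rw [fittingIdeal_congr φ, fittingIdeal_congr φ', fittingIdeal_pi_quotient_pow he ϖ r hr,
      fittingIdeal_pi_quotient_pow he' ϖ r hr, Ideal.span_singleton_eq_span_singleton] at this
    exact le_antisymm ((pow_dvd_pow_iff hϖ.ne_zero hϖ.not_isUnit).1 this.dvd)
      ((pow_dvd_pow_iff hϖ.ne_zero hϖ.not_isUnit).1 this.symm.dvd)
  -- Consecutive partial sums differ by a single exponent.
  have hee : ∀ r < max a b, e r = e' r := by
    intro r hr
    have h1 := hsum (r + 1) hr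
    rw [Finset.sum_range_succ, Finset.sum_range_succ, hsum r hr.le] at h1
    exact Nat.add_left_cancel h1
  exact ⟨φ.trans ((LinearEquiv.piCongrRight fun i : Fin (max a b) =>
    Submodule.quotEquivOfEq _ _ (by rw [hee i i.2])).trans φ'.symm)⟩

end DiscreteValuationRing

/-! ### Lifting and gluing local isomorphisms -/

section LocalIsomorphism

variable {R : Type*} [CommRing R]

/-- The map `f` becomes an isomorphism after localization at `S`, expressed without fractions. -/
structure IsIsoAway (S : Submonoid R) {M N : Type*} [AddCommGroup M] [Module R M]
    [AddCommGroup N] [Module R N] (f : M →ₗ[R] N) : Prop where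
  ker : ∀ x, f x = 0 → ∃ s ∈ S, s • x = 0
  coker : ∀ y, ∃ s ∈ S, ∃ x, s • y = f x

variable {M N : Type*} [AddCommGroup M] [Module R M] [AddCommGroup N] [Module R N]

theorem isIsoAway_iff (S : Submonoid R) (f : M →ₗ[R] N) :
    IsIsoAway S f ↔ Subsingleton (LocalizedModule S (LinearMap.ker f)) ∧
      Subsingleton (LocalizedModule S (N ⧸ LinearMap.range f)) := by
  rw [LocalizedModule.subsingleton_iff, LocalizedModule.subsingleton_iff]
  constructor
  · rintro ⟨h1, h2⟩
    refine ⟨fun ⟨x, hx⟩ => ?_, fun y => ?_⟩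
    · obtain ⟨s, hs, h⟩ := h1 x hx
      exact ⟨s, hs, Subtype.ext h⟩
    · obtain ⟨y, rfl⟩ := Submodule.Quotient.mk_surjective _ y
      obtain ⟨s, hs, x, h⟩ := h2 y
      refine ⟨s, hs, ?_⟩
      rw [← Submodule.Quotient.mk_smul, Submodule.Quotient.mk_eq_zero, h]
      exact ⟨x, rfl⟩
  · rintro ⟨h1, h2⟩
    refine ⟨fun x hx => ?_, fun y => ?_⟩
    · obtain ⟨s, hs, h⟩ := h1 ⟨x, hx⟩
      exact ⟨s, hs, congrArg Subtype.val h⟩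
    · obtain ⟨s, hs, h⟩ := h2 (Submodule.Quotient.mk y)
      rw [← Submodule.Quotient.mk_smul, Submodule.Quotient.mk_eq_zero] at h
      obtain ⟨x, hx⟩ := h
      exact ⟨s, hs, x, hx.symm⟩

theorem IsIsoAway.nonempty_linearEquiv {S : Submonoid R} {f : M →ₗ[R] N} (h : IsIsoAway S f) :
    Nonempty (LocalizedModule S M ≃ₗ[Localization S] LocalizedModule S N) := by
  refine ⟨LinearEquiv.ofBijective (LocalizedModule.map S f) ⟨?_, ?_⟩⟩
  · rw [injective_iff_map_eq_zero]
    intro z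
    induction z with | _ x t
    intro hz
    rw [LocalizedModule.map_mk, ← LocalizedModule.zero_mk t, LocalizedModule.mk_eq] at hz
    obtain ⟨c, h0⟩ := hz
    rw [smul_zero, smul_zero, smul_smul, Submonoid.smul_def] at h0
    rw [← map_smul] at h0
    obtain ⟨s, hs, h1⟩ := h.ker _ h0
    rw [← LocalizedModule.zero_mk t, LocalizedModule.mk_eq]
    refine ⟨⟨s, hs⟩ * c, ?_⟩
    rw [smul_zero, smul_zero, smul_smul, mul_assoc, mul_smul]
    exact h1
  · intro z
    induction z with | _ y t
    obtain ⟨s, hs, x, hx⟩ := h.coker y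
    refine ⟨LocalizedModule.mk x (⟨s, hs⟩ * t), ?_⟩
    rw [LocalizedModule.map_mk, ← hx]
    exact LocalizedModule.mk_cancel_common_left ⟨s, hs⟩ t y

/-- As `M` is finitely presented, some multiple `s • e` with `s ∈ S` comes from a map `M → N`; after
localization `s` is a unit. -/
theorem exists_isIsoAway [Module.FinitePresentation R M] {S : Submonoid R}
    (e : LocalizedModule S M ≃ₗ[Localization S] LocalizedModule S N) :
    ∃ f : M →ₗ[R] N, IsIsoAway S f := by
  let mM := LocalizedModule.mkLinearMap S M
  let mN := LocalizedModule.mkLinearMap S N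
  obtain ⟨f, s, hf⟩ := Module.FinitePresentation.exists_lift_of_isLocalizedModule S mN
    ((e.restrictScalars R).toLinearMap ∘ₗ mM)
  have hfx : ∀ x, mN (f x) = e (mM ((s : R) • x)) := fun x => by
    rw [map_smul, ← LinearEquiv.restrictScalars_apply R e, map_smul]
    exact LinearMap.congr_fun hf x
  refine ⟨f, fun x hx => ?_, fun y => ?_⟩
  · have h0 := hfx x
    rw [hx, map_zero, eq_comm, LinearEquiv.map_eq_zero_iff,
      IsLocalizedModule.eq_zero_iff S mM] at h0
    obtain ⟨c, hc⟩ := h0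
    exact ⟨c * s, S.mul_mem c.2 s.2, by rw [mul_smul]; exact hc⟩
  -- The preimage of `y` under `e` is a fraction `x / t`, so `f x` and `(s * t) • y` agree up to a
  -- factor `c ∈ S`.
  · obtain ⟨⟨x, t⟩, hxt⟩ := IsLocalizedModule.mk'_surjective S mM (e.symm (mN y))
    rw [Function.uncurry_apply_pair, IsLocalizedModule.mk'_eq_iff] at hxt
    have h1 : mN (((s : R) * t) • y) = mN (f x) := by
      rw [hfx, map_smul, map_smul, hxt, Submonoid.smul_def,
        ← LinearEquiv.restrictScalars_apply R e, map_smul, map_smul,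
        LinearEquiv.restrictScalars_apply, LinearEquiv.apply_symm_apply, mul_smul]
    obtain ⟨c, hc⟩ := (IsLocalizedModule.eq_iff_exists S mN).1 h1
    refine ⟨c * (s * t), S.mul_mem c.2 (S.mul_mem s.2 t.2), (c : R) • x, ?_⟩
    rw [mul_smul, map_smul]
    exact hc

/-- The glued map is ∑ b_p f_p. At `q` the terms with p ≠ q vanish because c_p is a unit there and
c_p b_p = a kills `N`; the remaining factor b_q is a unit. -/
theorem exists_isIsoAway_of_finset {P : Finset (Ideal R)} (hP : ∀ p ∈ P, p.IsPrime) {a : R}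
    (ha : ∀ y : N, a • y = 0) {b c : Ideal R → R} (hbc : ∀ p ∈ P, c p * b p = a)
    (hb : ∀ p ∈ P, b p ∉ p) (hc : ∀ p ∈ P, ∀ q ∈ P, p ≠ q → c p ∉ q)
    (hf : ∀ p ∈ P, ∀ _ : p.IsPrime, ∃ f : M →ₗ[R] N, IsIsoAway p.primeCompl f) :
    ∃ f : M →ₗ[R] N, ∀ p ∈ P, ∀ _ : p.IsPrime, IsIsoAway p.primeCompl f := by
  classical
  have hf' : ∀ p, ∃ f : M →ₗ[R] N, p ∈ P → ∀ _ : p.IsPrime, IsIsoAway p.primeCompl f := by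
    intro p
    by_cases hp : p ∈ P
    · obtain ⟨f, h⟩ := hf p hp (hP p hp)
      exact ⟨f, fun _ _ => h⟩
    · exact ⟨0, fun h => absurd h hp⟩
  choose f hf' using hf'
  refine ⟨∑ p ∈ P, b p • f p, fun q hq hq' => ?_⟩
  set t := ∏ p ∈ P.erase q, c p with ht
  have htq : t ∈ q.primeCompl := Submonoid.prod_mem _ fun p hp =>
    hc p (Finset.mem_of_mem_erase hp) q hq (Finset.ne_of_mem_erase hp)
  have hbq : b q ∈ q.primeCompl := hb q hq
  -- For p ≠ q in `P` the product `t` contains `c p`, so `t * b p` is a multiple of `a`.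
  have key : ∀ x, t • (∑ p ∈ P, b p • f p) x = f q ((t * b q) • x) := by
    intro x
    rw [LinearMap.sum_apply, Finset.smul_sum, ← Finset.add_sum_erase _ _ hq,
      Finset.sum_eq_zero, add_zero, LinearMap.smul_apply, map_smul, mul_smul]
    intro p hp
    rw [ht, ← Finset.mul_prod_erase _ _ hp, LinearMap.smul_apply, smul_smul,
      mul_right_comm, hbc p (Finset.mem_of_mem_erase hp), mul_smul, ha]
  refine ⟨fun x hx => ?_, fun y => ?_⟩
  · have h0 := key x
    rw [hx, smul_zero] at h0
    obtain ⟨s, hs, h⟩ := (hf' q hq hq').ker _ h0.symm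
    exact ⟨s * (t * b q), mul_mem hs (mul_mem htq hbq), by rw [mul_smul, h]⟩
  · obtain ⟨s, hs, x, h⟩ := (hf' q hq hq').coker y
    refine ⟨(t * b q) * s, mul_mem (mul_mem htq hbq) hs, t • x, ?_⟩
    rw [mul_smul, h, map_smul, key, map_smul]

end LocalIsomorphism

/-! ### The relation ∼ as equality at primes of height at most 1 -/

section IdealSim

variable {R : Type*} [CommRing R]

/-- `I` is finitely generated, so the product of the denominators of its generators works for all of
`I`. -/
theorem exists_mul_mem_of_map_le [IsNoetherianRing R] {S : Submonoid R} {I J : Ideal R}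
    (h : I.map (algebraMap R (Localization S)) ≤ J.map (algebraMap R (Localization S))) :
    ∃ s ∈ S, ∀ x ∈ I, s * x ∈ J := by
  classical
  obtain ⟨F, hF⟩ := IsNoetherian.noetherian I
  have h1 : ∀ x : F, ∃ s ∈ S, s * (x : R) ∈ J := fun x =>
    (IsLocalization.algebraMap_mem_map_algebraMap_iff S (Localization S) J x).1
      (h (Ideal.mem_map_of_mem _ (hF ▸ Submodule.subset_span x.2)))
  choose s hs hsx using h1
  refine ⟨∏ x, s x, Submonoid.prod_mem _ fun x _ => hs x, fun x hx => ?_⟩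
  rw [← hF] at hx
  induction hx using Submodule.span_induction with
  | mem y hy =>
    rw [← Finset.prod_erase_mul _ _ (Finset.mem_univ (⟨y, hy⟩ : F)), mul_assoc]
    exact J.mul_mem_left _ (hsx ⟨y, hy⟩)
  | zero => simp
  | add y z _ _ hy hz => rw [mul_add]; exact J.add_mem hy hz
  | smul r y _ hy => rw [smul_eq_mul, mul_left_comm]; exact J.mul_mem_left _ hy

/-- An ideal of height 2 is not contained in `p`, hence contains an element invertible at `p`. -/
theorem IdealPrec.map_le {I J : Ideal R} (h : IdealPrec I J) {p : Ideal R} [p.IsPrime]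
    (hp : p.height ≤ 1) :
    I.map (algebraMap R (Localization p.primeCompl))
      ≤ J.map (algebraMap R (Localization p.primeCompl)) := by
  obtain ⟨a, ha, haI⟩ := h
  have hap : ¬ a ≤ p := fun hle => by
    have := (Ideal.height_mono hle).trans hp
    rw [ha] at this
    exact absurd this (by norm_num)
  obtain ⟨s, hsa, hsp⟩ := SetLike.not_le_iff_exists.1 hap
  rw [Ideal.map_le_iff_le_comap]
  intro x hx
  exact (IsLocalization.algebraMap_mem_map_algebraMap_iff p.primeCompl _ J x).2
    ⟨s, hsp, haI (Ideal.mul_mem_mul hsa hx)⟩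

theorem idealPrec_of_map_le [IsNoetherianRing R] [IsLocalRing R]
    (hR : (IsLocalRing.maximalIdeal R).height = 2) {I J : Ideal R}
    (h : ∀ (p : Ideal R) [p.IsPrime], p.height ≤ 1 →
      I.map (algebraMap R (Localization p.primeCompl))
        ≤ J.map (algebraMap R (Localization p.primeCompl))) : IdealPrec I J := by
  -- The colon ideal may be larger than needed, even the whole ring; intersecting with the maximal
  -- ideal caps the height at 2.
  refine ⟨J.colon I ⊓ IsLocalRing.maximalIdeal R, le_antisymm ?_ ?_, ?_⟩
  · exact (Ideal.height_mono inf_le_right).trans hR.le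
  · rw [Ideal.height_eq_inf_minimalPrimes]
    refine le_iInf₂ fun q hq => ?_
    have hq' : q.IsPrime := hq.1.1
    rcases hq'.inf_le.1 hq.1.2 with hle | hle
    · by_contra hlt
      obtain ⟨s, hs, hsI⟩ := exists_mul_mem_of_map_le
        (h q (Order.le_of_lt_add_one (by rw [one_add_one_eq_two]; exact not_le.1 hlt)))
      exact hs (hle (Submodule.mem_colon.2 hsI))
    · exact hR.ge.trans (Ideal.height_mono hle)
  · rw [Ideal.mul_le]
    intro r hr x hx
    exact Submodule.mem_colon.1 hr.1 x hx

theorem idealSim_iff_forall_map_eq [IsNoetherianRing R] [IsLocalRing R]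
    (hR : (IsLocalRing.maximalIdeal R).height = 2) {I J : Ideal R} :
    IdealSim I J ↔ ∀ (p : Ideal R) [p.IsPrime], p.height ≤ 1 →
      I.map (algebraMap R (Localization p.primeCompl))
        = J.map (algebraMap R (Localization p.primeCompl)) :=
  ⟨fun h _ _ hp => le_antisymm (h.1.map_le hp) (h.2.map_le hp),
    fun h => ⟨idealPrec_of_map_le hR fun p _ hp => (h p hp).le,
      idealPrec_of_map_le hR fun p _ hp => (h p hp).ge⟩⟩

end IdealSim

/-! ### Primes of height 1 in a factorial domain -/

section HeightOne

variable {R : Type*} [CommRing R] [IsDomain R]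

/-- A height-one prime of a factorial domain is generated by a prime element, so the maximal ideal
of the localization is principal. -/
theorem isDiscreteValuationRing_localization_of_height_eq_one [IsNoetherianRing R]
    [UniqueFactorizationMonoid R] {p : Ideal R} [p.IsPrime] (hp : p.height = 1) :
    IsDiscreteValuationRing (Localization p.primeCompl) := by
  have hp0 := Ideal.ne_bot_of_height_eq_one hp
  obtain ⟨h, hhp, hprime⟩ := Ideal.IsPrime.exists_mem_prime_of_ne_bot ‹p.IsPrime› hp0
  have : IsNoetherianRing (Localization p.primeCompl) :=
    IsLocalization.isNoetherianRing p.primeCompl _ ‹_›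
  have hloc : IsLocalRing (Localization p.primeCompl) :=
    inferInstanceAs (IsLocalRing (Localization.AtPrime p))
  have : IsDomain (Localization p.primeCompl) :=
    IsLocalization.isDomain_localization p.primeCompl_le_nonZeroDivisors
  refine ((IsDiscreteValuationRing.TFAE (Localization p.primeCompl)
    (IsLocalization.AtPrime.not_isField R hp0 _)).out 0 4).2 ?_
  have hmap := congrArg (Ideal.map (algebraMap R (Localization p.primeCompl)))
    (Ideal.eq_span_singleton_of_height_eq_one hp hhp hprime)
  rw [Ideal.map_span, Set.image_singleton,
    IsLocalization.AtPrime.map_eq_maximalIdeal p (Localization p.primeCompl)] at hmap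
  exact ⟨⟨_, hmap⟩⟩

/-- With p = (h), `c` is the full power of h dividing `a`. A height-one prime containing it contains
h, hence equals p. This supplies the coefficients for gluing. -/
theorem exists_mul_eq_of_height_eq_one [IsNoetherianRing R] [UniqueFactorizationMonoid R] {a : R}
    (ha : a ≠ 0) {p : Ideal R} [p.IsPrime] (hp : p.height = 1) :
    ∃ c b : R, c * b = a ∧ b ∉ p ∧ ∀ q : Ideal R, q.IsPrime → q.height = 1 → p ≠ q → c ∉ q := by
  obtain ⟨h, hhp, hprime⟩ := Ideal.IsPrime.exists_mem_prime_of_ne_bot ‹p.IsPrime›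
    (Ideal.ne_bot_of_height_eq_one hp)
  have hspan := Ideal.eq_span_singleton_of_height_eq_one hp hhp hprime
  obtain ⟨n, b, hb, hab⟩ := WfDvdMonoid.max_power_factor ha hprime.irreducible
  refine ⟨h ^ n, b, hab.symm, ?_, fun q hq hq1 hne hmem => hne ?_⟩
  · rwa [hspan, Ideal.mem_span_singleton]
  · rw [hspan, Ideal.eq_span_singleton_of_height_eq_one hq1 (hq.mem_of_pow_mem n hmem) hprime]

/-- In a domain such a prime is minimal over (a), and a noetherian ring has finitely many minimal
primes over an ideal. -/
theorem finite_setOf_height_eq_one_mem [IsNoetherianRing R] {a : R} (ha : a ≠ 0) :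
    {p : Ideal R | p.IsPrime ∧ p.height = 1 ∧ a ∈ p}.Finite := by
  refine (Ideal.finite_minimalPrimes_of_isNoetherianRing R (Ideal.span {a})).subset ?_
  rintro p ⟨hp, hp1, hap⟩
  have : p.FiniteHeight := by simp [p.finiteHeight_iff, hp1]
  refine Ideal.mem_minimalPrimes_of_height_le ((Ideal.span_singleton_le_iff_mem _).2 hap) ?_
  rw [hp1, Order.one_le_iff_pos, pos_iff_ne_zero, Ne, Ideal.height_eq_zero_iff_eq_bot,
    Ideal.span_singleton_eq_bot]
  exact ha

theorem exists_smul_eq_zero_of_isTorsion {M : Type*} [AddCommGroup M] [Module R M]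
    [Module.Finite R M] (hM : Module.IsTorsion R M) : ∃ a : R, a ≠ 0 ∧ ∀ x : M, a • x = 0 := by
  obtain ⟨a, ha, ha0⟩ := Submodule.annihilator_top_inter_nonZeroDivisors hM
  exact ⟨a, nonZeroDivisors.ne_zero ha0, fun x => Submodule.mem_annihilator.1 ha x trivial⟩

theorem isTorsion_localizedModule {M : Type*} [AddCommGroup M] [Module R M] [Module.Finite R M]
    (hM : Module.IsTorsion R M) {S : Submonoid R} (hS : S ≤ nonZeroDivisors R) :
    Module.IsTorsion (Localization S) (LocalizedModule S M) := by
  obtain ⟨a, ha, hax⟩ := exists_smul_eq_zero_of_isTorsion hM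
  have : IsDomain (Localization S) := IsLocalization.isDomain_localization hS
  intro z
  refine ⟨⟨algebraMap R (Localization S) a, mem_nonZeroDivisors_of_ne_zero ?_⟩, ?_⟩
  · rwa [Ne, IsLocalization.to_map_eq_zero_iff _ hS]
  · induction z with | _ x t
    change algebraMap R (Localization S) a • LocalizedModule.mk x t = 0
    rw [algebraMap_smul, LocalizedModule.smul'_mk, hax, LocalizedModule.zero_mk]

end HeightOne

/-! ### The height of the maximal ideal of O⟦X⟧ -/

section PowerSeries

/-- The upper bound is Krull's height theorem for the generators ϖ and X; the lower bound is dim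
O⟦X⟧ ≥ dim O + 1. -/
theorem PowerSeries.maximalIdeal_height_eq_two (O : Type*) [CommRing O] [IsDomain O]
    [IsDiscreteValuationRing O] : (IsLocalRing.maximalIdeal O⟦X⟧).height = 2 := by
  refine le_antisymm ?_ ?_
  · obtain ⟨ϖ, hϖ⟩ := IsDiscreteValuationRing.exists_irreducible O
    have hle : IsLocalRing.maximalIdeal O⟦X⟧ ≤ Ideal.span {PowerSeries.C ϖ, PowerSeries.X} := by
      intro f hf
      rw [IsLocalRing.mem_maximalIdeal, mem_nonunits_iff, PowerSeries.isUnit_iff_constantCoeff,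
        ← mem_nonunits_iff, ← IsLocalRing.mem_maximalIdeal,
        (IsDiscreteValuationRing.irreducible_iff_uniformizer ϖ).1 hϖ,
        Ideal.mem_span_singleton] at hf
      obtain ⟨c, hc⟩ := hf
      -- The constant term of `f` is `ϖ * c`; what remains after subtracting it is divisible by X.
      obtain ⟨g, hg⟩ := PowerSeries.X_dvd_iff (φ := f - PowerSeries.C (ϖ * c)).2 (by simp [hc])
      rw [Ideal.mem_span_pair]
      exact ⟨PowerSeries.C c, g, by
        rw [mul_comm g, ← hg, map_mul]
        ring⟩
    have hne : Ideal.span {PowerSeries.C ϖ, (PowerSeries.X : O⟦X⟧)} ≠ ⊤ := by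
      intro htop
      have h1 : Ideal.span {PowerSeries.C ϖ, (PowerSeries.X : O⟦X⟧)}
          ≤ IsLocalRing.maximalIdeal O⟦X⟧ := by
        rw [Ideal.span_le]
        rintro _ (rfl | rfl)
        · rw [SetLike.mem_coe, IsLocalRing.mem_maximalIdeal, mem_nonunits_iff,
            PowerSeries.isUnit_iff_constantCoeff, PowerSeries.constantCoeff_C]
          exact hϖ.not_isUnit
        · rw [SetLike.mem_coe, IsLocalRing.mem_maximalIdeal, mem_nonunits_iff]
          exact PowerSeries.X_prime.not_isUnit
      exact Ideal.IsPrime.ne_top' (top_le_iff.1 (htop ▸ h1))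
    refine ((Ideal.height_mono hle).trans (Ideal.height_le_spanFinrank _ hne)).trans ?_
    have := Submodule.spanFinrank_span_le_ncard_of_finite (R := O⟦X⟧)
      (Set.toFinite {PowerSeries.C ϖ, (PowerSeries.X : O⟦X⟧)})
    exact_mod_cast this.trans (Set.ncard_insert_le _ _ |>.trans (by simp))
  · have h := ringKrullDim_succ_le_ringKrullDim_powerseries (R := O)
    rw [IsDiscreteValuationRing.ringKrullDim_eq_one,
      ← IsLocalRing.maximalIdeal_height_eq_ringKrullDim, one_add_one_eq_two] at h
    exact WithBot.coe_le_coe.1 h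

end PowerSeries

/-! ### Pseudo-isomorphism and Fitting ideals -/

section PseudoIsomorphismFitting

variable {R : Type*} [CommRing R] {M : Type*} [AddCommGroup M] [Module R M]
  {N : Type*} [AddCommGroup N] [Module R N]

theorem isPseudoIsomorphic_iff :
    IsPseudoIsomorphic R M N ↔ ∃ f : M →ₗ[R] N, ∀ (p : Ideal R) [p.IsPrime], p.height ≤ 1 →
      IsIsoAway p.primeCompl f := by
  refine exists_congr fun f => ⟨fun h p _ hp => (isIsoAway_iff _ f).2 ⟨h.1 p hp, h.2 p hp⟩,
    fun h => ⟨fun p _ hp => ((isIsoAway_iff _ f).1 (h p hp)).1,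
      fun p _ hp => ((isIsoAway_iff _ f).1 (h p hp)).2⟩⟩

variable [IsDomain R] [IsNoetherianRing R] [Module.Finite R M] [Module.Finite R N]

theorem isPseudoIsomorphic_of_forall_exists [UniqueFactorizationMonoid R]
    (hM : Module.IsTorsion R M) (hN : Module.IsTorsion R N)
    (h : ∀ (p : Ideal R) [p.IsPrime], p.height = 1 → ∃ f : M →ₗ[R] N, IsIsoAway p.primeCompl f) :
    IsPseudoIsomorphic R M N := by
  obtain ⟨a₁, ha₁, hM⟩ := exists_smul_eq_zero_of_isTorsion hM
  obtain ⟨a₂, ha₂, hN⟩ := exists_smul_eq_zero_of_isTorsion hN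
  -- One element annihilating both modules, so that both vanish at primes not containing it.
  set a := a₁ * a₂
  have ha : a ≠ 0 := mul_ne_zero ha₁ ha₂
  have haM : ∀ x : M, a • x = 0 := fun x => by
    rw [mul_smul, smul_comm, hM, smul_zero]
  have haN : ∀ x : N, a • x = 0 := fun x => by rw [mul_smul, hN, smul_zero]
  have hfin := finite_setOf_height_eq_one_mem ha
  have hbc : ∀ p : Ideal R, ∃ c b : R, p.IsPrime → p.height = 1 → c * b = a ∧ b ∉ p ∧
      ∀ q : Ideal R, q.IsPrime → q.height = 1 → p ≠ q → c ∉ q := by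
    intro p
    by_cases hp : p.IsPrime ∧ p.height = 1
    · have := hp.1
      obtain ⟨c, b, h⟩ := exists_mul_eq_of_height_eq_one ha hp.2
      exact ⟨c, b, fun _ _ => h⟩
    · exact ⟨0, 0, fun h1 h2 => absurd ⟨h1, h2⟩ hp⟩
  choose c b hbc using hbc
  have hmem : ∀ p, p ∈ hfin.toFinset ↔ p.IsPrime ∧ p.height = 1 ∧ a ∈ p := fun p => by simp
  obtain ⟨f, hf⟩ := exists_isIsoAway_of_finset (M := M) (P := hfin.toFinset)
    (fun p hp => ((hmem p).1 hp).1) haN (b := b) (c := c)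
    (fun p hp => (hbc p ((hmem p).1 hp).1 ((hmem p).1 hp).2.1).1)
    (fun p hp => (hbc p ((hmem p).1 hp).1 ((hmem p).1 hp).2.1).2.1)
    (fun p hp q hq => (hbc p ((hmem p).1 hp).1 ((hmem p).1 hp).2.1).2.2 q
      ((hmem q).1 hq).1 ((hmem q).1 hq).2.1)
    (fun p hp _ => h p ((hmem p).1 hp).2.1)
  refine isPseudoIsomorphic_iff.2 ⟨f, fun p hp hp1 => ?_⟩
  by_cases hap : a ∈ p
  -- Height 0 is excluded: the zero ideal does not contain `a`.
  · refine hf p ((hmem p).2 ⟨hp, le_antisymm hp1 ?_, hap⟩) hp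
    rw [Order.one_le_iff_pos, pos_iff_ne_zero, Ne, Ideal.height_eq_zero_iff_eq_bot]
    rintro rfl
    exact ha ((Submodule.mem_bot R).1 hap)
  -- Here `a` is invertible at `p` and kills `M` and `N`, so any map is an isomorphism there.
  · exact ⟨fun x _ => ⟨a, hap, haM x⟩, fun y => ⟨a, hap, 0, by rw [haN, map_zero]⟩⟩

theorem isPseudoIsomorphic_iff_forall_idealSim_fittingIdeal [UniqueFactorizationMonoid R]
    [IsLocalRing R] (hR : (IsLocalRing.maximalIdeal R).height = 2)
    (hM : Module.IsTorsion R M) (hN : Module.IsTorsion R N) :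
    IsPseudoIsomorphic R M N ↔ ∀ i : ℕ, IdealSim (fittingIdeal R M i) (fittingIdeal R N i) := by
  have : Module.FinitePresentation R M := Module.finitePresentation_of_finite R M
  have : Module.FinitePresentation R N := Module.finitePresentation_of_finite R N
  simp only [idealSim_iff_forall_map_eq hR, ← fittingIdeal_localizedModule]
  constructor
  · rw [isPseudoIsomorphic_iff]
    rintro ⟨f, hf⟩ i p _ hp
    obtain ⟨e⟩ := (hf p hp).nonempty_linearEquiv
    exact fittingIdeal_congr e i
  · intro h
    refine isPseudoIsomorphic_of_forall_exists hM hN fun p _ hp => ?_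
    have : IsDomain (Localization p.primeCompl) :=
      IsLocalization.isDomain_localization p.primeCompl_le_nonZeroDivisors
    have := isDiscreteValuationRing_localization_of_height_eq_one hp
    obtain ⟨e⟩ := nonempty_linearEquiv_of_fittingIdeal_eq
      (isTorsion_localizedModule hM p.primeCompl_le_nonZeroDivisors)
      (isTorsion_localizedModule hN p.primeCompl_le_nonZeroDivisors) fun i => h i p hp.le
    exact exists_isIsoAway e

end PseudoIsomorphismFitting

theorem mainTheorem10 {O : Type*} [CommRing O] [IsDomain O] [IsDiscreteValuationRing O]
    [IsAdicComplete (IsLocalRing.maximalIdeal O) O] [Finite (IsLocalRing.ResidueField O)]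
    (M : Type*) [AddCommGroup M] [Module O⟦X⟧ M] [Module.Finite O⟦X⟧ M] [Nontrivial M]
    (hM : Module.IsTorsion O⟦X⟧ M)
    (N : Type*) [AddCommGroup N] [Module O⟦X⟧ N] [Module.Finite O⟦X⟧ N]
    (hN : Module.IsTorsion O⟦X⟧ N) :
    IsPseudoIsomorphic O⟦X⟧ M N ↔
      ∀ i : ℕ, IdealSim (fittingIdeal O⟦X⟧ M i) (fittingIdeal O⟦X⟧ N i) :=
  isPseudoIsomorphic_iff_forall_idealSim_fittingIdeal
    (PowerSeries.maximalIdeal_height_eq_two O) hM hN
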